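/- Let $d\ge 0$ and let $K$ be a $d$-dimensional (finite) shellable simplicial complex: $K$ is pure and its facets can be ordered $F_1,\dots,F_t$ so that for each $1<i\le t$ the complex $F_i\cap\bigcup_{j<i}F_j$ is a non-empty union of facets of $\partial F_i$. Let $P_K$ be the poset of all faces of $K$ (including $\emptyset$) ordered by inclusion, in which a face with $r$ vertices has rank $r$, and let $\Delta$ be the order complex of the subposet $P=\{x\in P_K:\operatorname{rank}(x)\in[d]\}$, i.e. of $P_K$ with the empty face and the facets of $K$ removed. For $S\subseteq[d]=\{1,\dots,d\}$ let $f_S(\Delta)$ be the number of maximal chains of $P_S=\{x\in P:\operatorname{rank}(x)\in S\}$ and let $h_S(\Delta)=\sum_{R\subseteq S}(-1)^{|S\setminus R|}f_R(\Delta)$. For a permutation $\sigma=\sigma_1\sigma_2\cdots\sigma_{d+1}$ of $[d+1]$ let $d(\sigma)=\{i\in[d]:\sigma_i>\sigma_{i+1}\}$ be its descent set. Write $\sigma\le_w\tau$ if $\tau$ can be obtained from $\sigma$ by a (possibly empty) sequence of switches, a switch being the interchange of two adjacent letters at positions $i,i+1$ of a permutation where $i$ is not in its descent set. For $S\subseteq[d]$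 let $D_S$ be the set of permutations of $[d+1]$ with descent set $S$, and say that $S$ dominates $T$ if there is an injection $\phi:D_T\to D_S$ with $\tau\le_w\phi(\tau)$ for all $\tau\in D_T$. Theorem. If $S,T\subseteq[d]$ and $S$ dominates $T$, then $h_T(\Delta)\le h_S(\Delta)$. -/

import Mathlib

namespace FlagH

/-! ### Simplicial complexes and shellability

A (finite) simplicial complex is a `PreAbstractSimplicialComplex V`; Mathlib's convention is that
only the nonempty faces are recorded. -/

section Complexes

variable {V : Type*}

/-- `s` is a facet, i.e. a maximal face, of `K`. -/
def IsFacet (K : PreAbstractSimplicialComplex V) (s : Finset V) : Prop :=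
  Maximal (fun u => u ∈ K) s

/-- `K` has dimension `d`: the largest faces of `K` have `d + 1` vertices.
In particular `K` has a face. -/
def HasDim (K : PreAbstractSimplicialComplex V) (d : ℕ) : Prop :=
  IsGreatest {n | ∃ s ∈ K, s.card = n} (d + 1)

/-- `K` is pure: all facets have the same dimension. -/
def IsPure (K : PreAbstractSimplicialComplex V) : Prop :=
  ∀ s t, IsFacet K s → IsFacet K t → s.card = t.card

/-- `g` is a facet of the boundary complex `∂F`, whose faces (including the empty one) are
the proper subsets of `F`. -/
def IsBoundaryFacet (F g : Finset V) : Prop :=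
  Maximal (fun u => u ⊂ F) g

/-- The sequence `F 0, …, F (t - 1)` is a shelling order of the facets of `K`: it lists every
facet exactly once and, for every `i` but the first, the complex of all `s ⊆ F i` that lie in an
earlier `F j` is the union of the simplices spanned by a nonempty collection of facets of
`∂ (F i)`. -/
def IsShelling (K : PreAbstractSimplicialComplex V) {t : ℕ} (F : Fin t → Finset V) : Prop :=
  Function.Injective F ∧ Set.range F = {s | IsFacet K s} ∧
    ∀ i : Fin t, 0 < (i : ℕ) →
      ∃ G : Set (Finset V), G.Nonempty ∧ (∀ g ∈ G, IsBoundaryFacet (F i) g) ∧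
        {s | s ⊆ F i ∧ ∃ j < i, s ⊆ F j} = {s | ∃ g ∈ G, s ⊆ g}

/-- `K` is shellable: it is pure and its (finitely many) facets have a shelling order. -/
def IsShellable (K : PreAbstractSimplicialComplex V) : Prop :=
  IsPure K ∧ ∃ (t : ℕ) (F : Fin t → Finset V), IsShelling K F

/-- The face poset `P_K`: all faces of `K`, including the empty face, ordered by inclusion. -/
abbrev FacePoset (K : PreAbstractSimplicialComplex V) : Type _ :=
  {s : Finset V // s = ∅ ∨ s ∈ K}

/-- The rank of a face in the face poset is its number of vertices. -/
def faceRank (K : PreAbstractSimplicialComplex V) (s : FacePoset K) : ℕ :=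
  s.1.card

end Complexes

/-! ### Rank selection and flag vectors -/

section FlagVectors

variable {P : Type*}

/-- The rank-selected subposet `P_S = {x ∈ P : rank x ∈ S}`. -/
abbrev RankSelected (rk : P → ℕ) (S : Finset ℕ) : Type _ :=
  {x : P // rk x ∈ S}

/-- The flag f-vector of the order complex of a poset `P` with rank function `rk`: `f_S` is the
number of maximal chains of `P_S` (Mathlib calls maximal chains flags). -/
noncomputable def flagF [PartialOrder P] (rk : P → ℕ) (S : Finset ℕ) : ℕ :=
  Nat.card (Flag (RankSelected rk S))

/-- The flag h-vector `h_S = ∑_{T ⊆ S} (-1)^{|S - T|} f_T`. -/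
noncomputable def flagHVec [PartialOrder P] (rk : P → ℕ) (S : Finset ℕ) : ℤ :=
  ∑ T ∈ S.powerset, (-1) ^ (S \ T).card * (flagF rk T : ℤ)

end FlagVectors

/-- The poset `(P_K)_{[d]}`: the nonempty faces of `K` with at most `d` vertices. For `K` pure of
dimension `d`, this is the face poset with the empty face and the facets removed. -/
abbrev TruncatedFacePoset {V : Type*} (K : PreAbstractSimplicialComplex V) (d : ℕ) : Type _ :=
  RankSelected (faceRank K) (Finset.Icc 1 d)

/-- The rank function of `(P_K)_{[d]}`, inherited from `P_K`. -/
def truncatedRank {V : Type*} (K : PreAbstractSimplicialComplex V) (d : ℕ)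
    (x : TruncatedFacePoset K d) : ℕ :=
  faceRank K x.1

/-! ### Descents, the weak order and dominance

A permutation `σ` of `{1, …, n + 1}` is modelled by `σ : Equiv.Perm (Fin (n + 1))`, with word
`σ 0, σ 1, …, σ n`. The position `i ∈ {1, …, n}` of the word, comparing the
`i`-th letter with the next one, corresponds to `i - 1 : Fin n`. -/

/-- The descent set, a subset of `{1, …, n}`. -/
def descentSet {n : ℕ} (σ : Equiv.Perm (Fin (n + 1))) : Finset ℕ :=
  (Finset.univ.filter fun i : Fin n => σ i.succ < σ i.castSucc).image fun i : Fin n => (i : ℕ) + 1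

/-- `τ` arises from `σ` by a switch: two adjacent letters that do not form a descent are
interchanged. -/
def IsSwitch {n : ℕ} (σ τ : Equiv.Perm (Fin (n + 1))) : Prop :=
  ∃ i : Fin n, σ i.castSucc < σ i.succ ∧ τ = σ * Equiv.swap i.castSucc i.succ

/-- The weak order: `τ` can be obtained from `σ` by a (possibly empty) sequence of switches. -/
def WeakLE {n : ℕ} (σ τ : Equiv.Perm (Fin (n + 1))) : Prop :=
  Relation.ReflTransGen IsSwitch σ τ

/-- For `S, T ⊆ {1, …, n}`: `S` dominates `T` if there is an injection `φ` from the permutations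
of `{1, …, n + 1}` with descent set `T` to those with descent set `S` such that `τ ≤ φ τ` in the
weak order for all `τ`. -/
def Dominates (n : ℕ) (S T : Finset ℕ) : Prop :=
  ∃ φ : {τ : Equiv.Perm (Fin (n + 1)) // descentSet τ = T} →
      {σ : Equiv.Perm (Fin (n + 1)) // descentSet σ = S},
    Function.Injective φ ∧ ∀ τ, WeakLE τ.1 (φ τ).1

end FlagH

namespace FlagH

open Finset

/-! ### Permutations and the weak order -/

section Permutations

variable {n : ℕ}

/-! A shelling assigns each maximal chain of `P_T` to the first facet containing its top face, that
is, the unique facet `F i` with restriction ⊆ top ⊆ `F i` (`IsShelling.restriction_subset_iff`).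
Inside `F i` the chain is an ordered partition of the vertices with cuts at `T`; writing each block
in increasing order of labels encodes it as a permutation with descents in `T`.

Label each facet so that its restriction is an upper set of labels. The letters after the last cut
increase, so the top face contains the restriction exactly when the last letter lies outside it.
Hence `f_T` counts pairs (facet, permutation with descents in `T`) under this condition
(`flagF_eq_card`), and by inclusion-exclusion `h_T` counts those with descent set exactly `T`
(`flagHVec_eq_card`).

A switch never raises the last letter, so moving up in the weak order keeps it outside the upper
set. Applying the dominance injection facet by facet therefore injects the pairs for `T` into those
for `S`. -/

theorem IsSwitch.last_le {σ τ : Equiv.Perm (Fin (n + 1))} (h : IsSwitch σ τ) :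
    τ (Fin.last n) ≤ σ (Fin.last n) := by
  obtain ⟨i, hi, rfl⟩ := h
  rw [Equiv.Perm.mul_apply]
  by_cases hl : i.succ = Fin.last n
  · rw [← hl, Equiv.swap_apply_right]
    exact hi.le
  · rw [Equiv.swap_apply_of_ne_of_ne (Fin.castSucc_lt_last i).ne' (Ne.symm hl)]

theorem WeakLE.last_le {σ τ : Equiv.Perm (Fin (n + 1))} (h : WeakLE σ τ) :
    τ (Fin.last n) ≤ σ (Fin.last n) := by
  induction h with
  | refl => exact le_rfl
  | tail _ h ih => exact h.last_le.trans ih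

/-- The letters of a permutation increase along every interval of positions that avoids the
descent set. -/
theorem lt_of_forall_notMem_descentSet {w : Equiv.Perm (Fin (n + 1))} {p q : Fin (n + 1)}
    (hpq : p < q) (h : ∀ k ∈ descentSet w, ¬ ((p : ℕ) < k ∧ k ≤ q)) : w p < w q := by
  induction q using Fin.induction with
  | zero => exact absurd hpq (Fin.not_lt_zero p)
  | succ i ih =>
    have hstep : w i.castSucc < w i.succ := by
      by_contra hlt
      have hne : w i.succ ≠ w i.castSucc :=
        fun he => (Fin.castSucc_lt_succ (i := i)).ne' (w.injective he)
      refine h ((i : ℕ) + 1) ?_ ⟨?_, by simp⟩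
      · simp only [descentSet, mem_image, mem_filter, mem_univ, true_and]
        exact ⟨i, lt_of_le_of_ne (not_lt.1 hlt) hne, rfl⟩
      · simpa [Fin.lt_def] using hpq
    rcases (Fin.le_castSucc_iff.2 hpq).eq_or_lt with he | hlt
    · rwa [he]
    · refine (ih hlt fun k hk hc => h k hk ⟨hc.1, hc.2.trans ?_⟩).trans hstep
      simp

/-- A permutation with descents in `T` is the stable sort of the function recording in which
of the segments cut out by `T` a letter lies. -/
theorem eq_sort_of_descentSet_subset {T : Finset ℕ} {w : Equiv.Perm (Fin (n + 1))}
    (hw : descentSet w ⊆ T) {b : Fin (n + 1) → ℕ}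
    (hb : ∀ p, b (w p) = #{k ∈ T | k ≤ (p : ℕ)}) : w = Tuple.sort b := by
  rw [Tuple.eq_sort_iff]
  refine ⟨fun p q hpq => ?_, fun p q hpq he => ?_⟩
  · simp only [Function.comp, hb]
    exact card_le_card fun k hk => by
      simp only [mem_filter] at hk ⊢
      exact ⟨hk.1, hk.2.trans hpq⟩
  -- Equal counts mean that no cut separates `p` from `q`, so the letters increase between them.
  · refine lt_of_forall_notMem_descentSet hpq fun k hk hc => ?_
    rw [hb, hb] at he
    refine he.not_lt (card_lt_card (Finset.ssubset_iff_subset_ne.2 ⟨fun l hl => ?_, fun hs => ?_⟩))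
    · simp only [mem_filter] at hl ⊢
      exact ⟨hl.1, hl.2.trans hpq.le⟩
    · have : k ∈ T.filter (· ≤ (p : ℕ)) := hs ▸ mem_filter.2 ⟨hw hk, hc.2⟩
      exact absurd (mem_filter.1 this).2 (not_le.2 hc.1)

/-- The prefixes at the cuts determine the segment of every letter, and both permutations are the
stable sort by segment. -/
theorem eq_of_forall_lt_iff {T : Finset ℕ} {w w' : Equiv.Perm (Fin (n + 1))}
    (hw : descentSet w ⊆ T) (hw' : descentSet w' ⊆ T)
    (h : ∀ k ∈ T, ∀ x, (w.symm x : ℕ) < k ↔ (w'.symm x : ℕ) < k) : w = w' := by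
  rw [eq_sort_of_descentSet_subset hw (b := fun x => #{k ∈ T | k ≤ (w.symm x : ℕ)}) (by simp),
    eq_sort_of_descentSet_subset hw' (b := fun x => #{k ∈ T | k ≤ (w.symm x : ℕ)})]
  intro p
  congr 1
  refine filter_congr fun k hk => ?_
  rw [← not_lt, h k hk, w'.symm_apply_apply, not_lt]

theorem mem_iff_lt_card_of_isLowerSet {m : ℕ} {s : Finset (Fin m)}
    (hs : IsLowerSet (s : Set (Fin m))) (p : Fin m) : p ∈ s ↔ (p : ℕ) < #s := by
  constructor
  · intro hp
    have : Finset.Iic p ⊆ s := fun q hq => hs (mem_Iic.1 hq) hp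
    simpa using card_le_card this
  · intro hp
    by_contra hps
    have : s ⊆ Finset.Iio p := fun q hq => mem_Iio.2 (lt_of_not_ge fun hpq => hps (hs hpq hq))
    have := card_le_card this
    simp at this
    omega

/-- Every nested family of sets of letters, with sizes in `T`, is the family of prefixes of a
permutation with descents in `T`. -/
theorem exists_perm_of_nested {T : Finset ℕ} {A : ℕ → Finset (Fin (n + 1))}
    (hcard : ∀ k ∈ T, #(A k) = k) (hmono : ∀ k ∈ T, ∀ l ∈ T, k ≤ l → A k ⊆ A l) :
    ∃ w : Equiv.Perm (Fin (n + 1)), descentSet w ⊆ T ∧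
      ∀ k ∈ T, ∀ p, w p ∈ A k ↔ (p : ℕ) < k := by
  -- `b x` counts the sets of the family that miss `x`, so sorting by `b` lists smaller sets first;
  -- ties are broken in increasing order.
  set b : Fin (n + 1) → ℕ := fun x => #{k ∈ T | x ∉ A k} with hb
  obtain ⟨hm, hlt⟩ := Tuple.eq_sort_iff.1 (rfl : Tuple.sort b = Tuple.sort b)
  have hdown : ∀ k ∈ T, ∀ x y, b x ≤ b y → y ∈ A k → x ∈ A k := by
    intro k hk x y hxy hy
    by_contra hx
    refine hxy.not_gt (card_lt_card (Finset.ssubset_iff_subset_ne.2 ⟨fun l hl => ?_, fun hs => ?_⟩))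
    · rw [mem_filter] at hl ⊢
      refine ⟨hl.1, fun hxl => ?_⟩
      rcases le_total k l with h | h
      · exact hl.2 (hmono k hk l hl.1 h hy)
      · exact hx (hmono l hl.1 k hk h hxl)
    · have : k ∈ T.filter (y ∉ A ·) := hs ▸ mem_filter.2 ⟨hk, hx⟩
      exact (mem_filter.1 this).2 hy
  have hprefix : ∀ k ∈ T, ∀ p, Tuple.sort b p ∈ A k ↔ (p : ℕ) < k := by
    intro k hk p
    have hlow : IsLowerSet (((A k).map (Tuple.sort b).symm.toEmbedding :
        Finset (Fin (n + 1))) : Set (Fin (n + 1))) := by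
      intro q r hrq hq
      simp only [mem_coe, mem_map_equiv, Equiv.symm_symm] at hq ⊢
      exact hdown k hk _ _ (hm hrq) hq
    have := mem_iff_lt_card_of_isLowerSet hlow p
    rwa [card_map, hcard k hk, mem_map_equiv, Equiv.symm_symm] at this
  refine ⟨Tuple.sort b, fun k hk => ?_, hprefix⟩
  simp only [descentSet, mem_image, mem_filter, mem_univ, true_and] at hk
  obtain ⟨i, hi, rfl⟩ := hk
  -- Without a cut between the two positions their letters tie under `b`, so the stable sort leaves
  -- them increasing.
  by_contra hiT
  refine hi.not_gt (hlt _ _ Fin.castSucc_lt_succ ?_)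
  simp only [hb]
  congr 1
  refine filter_congr fun k hk => not_congr ?_
  rw [hprefix k hk, hprefix k hk]
  have : k ≠ i + 1 := fun h => hiT (h ▸ hk)
  simp only [Fin.val_castSucc, Fin.val_succ]
  omega

end Permutations

/-! ### Inclusion-exclusion over rank sets -/

/-- Complementation in `T` turns the sum into the alternating sum over the subsets of `T \ D`, which
vanishes unless that set is empty. -/
theorem sum_powerset_neg_one_pow_of_subset {α : Type*} [DecidableEq α] (D T : Finset α) :
    ∑ R ∈ T.powerset, (-1 : ℤ) ^ #(T \ R) * (if D ⊆ R then 1 else 0) =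
      if D = T then 1 else 0 := by
  by_cases hDT : D ⊆ T
  · have : ∑ R ∈ T.powerset, (-1 : ℤ) ^ #(T \ R) * (if D ⊆ R then 1 else 0) =
        ∑ Q ∈ (T \ D).powerset, (-1 : ℤ) ^ #Q := by
      simp only [mul_ite, mul_one, mul_zero]
      rw [← sum_filter]
      refine sum_nbij' (T \ ·) (T \ ·) ?_ ?_ ?_ ?_ ?_
      · intro R hR
        simp only [mem_filter, mem_powerset] at hR ⊢
        exact sdiff_subset_sdiff le_rfl hR.2
      · intro Q hQ
        simp only [mem_filter, mem_powerset] at hQ ⊢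
        refine ⟨sdiff_subset, fun x hx => mem_sdiff.2 ⟨hDT hx, fun h => ?_⟩⟩
        exact (mem_sdiff.1 (hQ h)).2 hx
      · intro R hR
        simp only [mem_filter, mem_powerset] at hR
        exact Finset.sdiff_sdiff_eq_self hR.1
      · intro Q hQ
        exact Finset.sdiff_sdiff_eq_self ((mem_powerset.1 hQ).trans sdiff_subset)
      · simp
    rw [this, sum_powerset_neg_one_pow_card]
    refine if_congr ?_ rfl rfl
    rw [sdiff_eq_empty_iff_subset]
    exact ⟨fun h => hDT.antisymm h, fun h => h.ge⟩
  · rw [if_neg fun h => hDT h.le]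
    refine sum_eq_zero fun R hR => ?_
    rw [if_neg fun h => hDT (h.trans (mem_powerset.1 hR)), mul_zero]

/-- If the flag f-vector counts objects by `D x ⊆ R`, then the flag h-vector counts them by
`D x = T`. -/
theorem sum_powerset_neg_one_pow_mul_card {α β : Type*} [DecidableEq α] (X : Finset β)
    (D : β → Finset α) (T : Finset α) :
    ∑ R ∈ T.powerset, (-1 : ℤ) ^ #(T \ R) * (#{x ∈ X | D x ⊆ R} : ℤ) =
      #{x ∈ X | D x = T} := by
  simp only [card_filter, Nat.cast_sum, Nat.cast_ite, Nat.cast_one, Nat.cast_zero, mul_sum]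
  rw [sum_comm]
  exact sum_congr rfl fun x _ => sum_powerset_neg_one_pow_of_subset (D x) T

/-! ### Restrictions of facets in a shelling -/

section Complexes

variable {V : Type*}

theorem IsBoundaryFacet.exists_eq_erase [DecidableEq V] {F g : Finset V}
    (h : IsBoundaryFacet F g) : ∃ v ∈ F, g = F.erase v := by
  obtain ⟨v, hv, hvg⟩ := exists_of_ssubset h.1
  have hle : g ≤ F.erase v := subset_erase.2 ⟨h.1.1, hvg⟩
  exact ⟨v, hv, hle.antisymm (h.2 (erase_ssubset hv) hle)⟩

open Classical in
/-- The restriction of the facet `F i`: the smallest face of `F i` that lies in no earlier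
facet. -/
noncomputable def restriction {t : ℕ} (F : Fin t → Finset V) (i : Fin t) : Finset V :=
  {v ∈ F i | ∃ j < i, (F i).erase v ⊆ F j}

/-- If `A` lies in an earlier facet, the shelling condition puts it in some `(F i).erase v` that
also lies in an earlier facet, so `A` misses the restriction vertex `v`. The converse needs only the
definition of the restriction. -/
theorem IsShelling.restriction_subset_iff {K : PreAbstractSimplicialComplex V} {t : ℕ}
    {F : Fin t → Finset V} (hF : IsShelling K F) {i : Fin t} {A : Finset V} (hA : A ⊆ F i) :
    restriction F i ⊆ A ↔ ∀ j < i, ¬ A ⊆ F j := by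
  classical
  constructor
  · intro hr j hj hAj
    obtain ⟨G, -, hG, hGeq⟩ := hF.2.2 i (lt_of_le_of_lt (Nat.zero_le _) hj)
    have hAG : A ∈ {s | ∃ g ∈ G, s ⊆ g} := hGeq ▸ ⟨hA, j, hj, hAj⟩
    obtain ⟨g, hg, hAg⟩ := hAG
    have hgG : g ∈ {s | ∃ g ∈ G, s ⊆ g} := ⟨g, hg, le_rfl⟩
    rw [← hGeq] at hgG
    obtain ⟨v, hv, rfl⟩ := (hG g hg).exists_eq_erase
    have hvr : v ∈ restriction F i := by
      rw [restriction, mem_filter]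
      refine ⟨hv, ?_⟩
      obtain ⟨-, j', hj', h⟩ := hgG
      exact ⟨j', hj', by convert h⟩
    exact notMem_erase v _ (hAg (hr hvr))
  · intro h v hv
    rw [restriction, mem_filter] at hv
    obtain ⟨hvF, j, hj, hvj⟩ := hv
    by_contra hvA
    exact h j hj (fun x hx => hvj (mem_erase.2 ⟨fun he => hvA (he ▸ hx), hA hx⟩))

/-- The vertices of a facet can be labelled so that the labels of any given set of vertices
form an upper set. -/
theorem exists_labelling (F R : Finset V) {m : ℕ} (hF : #F = m) :
    ∃ e : Fin m → V, Function.Injective e ∧ (∀ v, v ∈ F ↔ ∃ p, e p = v) ∧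
      ∀ p q, p ≤ q → e p ∈ R → e q ∈ R := by
  classical
  let e₀ : Fin m ≃ F := (F.equivFinOfCardEq hF).symm
  -- Sorting by the indicator of `R` puts the vertices in `R` last.
  let f : Fin m → ℕ := fun p => if (e₀ p : V) ∈ R then 1 else 0
  refine ⟨fun p => e₀ (Tuple.sort f p), ?_, fun v => ⟨fun hv => ?_, ?_⟩, fun p q hpq hp => ?_⟩
  · exact Subtype.val_injective.comp (e₀.injective.comp (Tuple.sort f).injective)
  · exact ⟨(Tuple.sort f).symm (e₀.symm ⟨v, hv⟩), by simp⟩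
  · rintro ⟨p, rfl⟩
    exact (e₀ _).2
  · have := Tuple.monotone_sort f hpq
    by_contra hq
    simp [f, hp, hq] at this

theorem HasDim.exists_isFacet {K : PreAbstractSimplicialComplex V} {d : ℕ} (h : HasDim K d)
    {s : Finset V} (hs : s ∈ K) : ∃ u, IsFacet K u ∧ s ⊆ u := by
  -- A face above `s` of least codimension is maximal.
  have hex : ∃ m, ∃ u ∈ K, s ⊆ u ∧ d + 1 - #u = m := ⟨_, s, hs, le_rfl, rfl⟩
  classical
  obtain ⟨u, hu, hsu, hm⟩ := Nat.find_spec hex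
  refine ⟨u, ⟨hu, fun x hx hux => ?_⟩, hsu⟩
  have hmin := Nat.find_min' hex ⟨x, hx, hsu.trans hux, rfl⟩
  have hxd : #x ≤ d + 1 := h.2 ⟨x, hx, rfl⟩
  have hux' := card_le_card hux
  exact (eq_of_subset_of_card_le hux (by omega)).ge

theorem HasDim.card_facet {K : PreAbstractSimplicialComplex V} {d : ℕ} (h : HasDim K d)
    (hp : IsPure K) {s : Finset V} (hs : IsFacet K s) : #s = d + 1 := by
  obtain ⟨u, hu, hcard⟩ := h.1
  obtain ⟨x, hx, hux⟩ := h.exists_isFacet hu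
  have := card_le_card hux
  have hxd : #x ≤ d + 1 := h.2 ⟨x, hx.1, rfl⟩
  have := hp s x hs hx
  omega

end Complexes

/-! ### Flags of the rank-selected face poset -/

section Flags

variable {V : Type*} {K : PreAbstractSimplicialComplex V} {d : ℕ} {T : Finset ℕ}

/-- The set of vertices of an element of the rank-selected face poset. -/
abbrev vertices (x : RankSelected (truncatedRank K d) T) : Finset V :=
  x.1.1.1

theorem card_vertices_mem (x : RankSelected (truncatedRank K d) T) : #(vertices x) ∈ T :=
  x.2

theorem vertices_mem (x : RankSelected (truncatedRank K d) T) : vertices x ∈ K := by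
  rcases x.1.1.2 with h | h
  · have := (mem_Icc.1 x.1.2).1
    simp [faceRank, h] at this
  · exact h

theorem vertices_injective :
    Function.Injective (vertices : RankSelected (truncatedRank K d) T → Finset V) :=
  Subtype.val_injective.comp (Subtype.val_injective.comp Subtype.val_injective)

theorem exists_vertices_eq (hT : T ⊆ Icc 1 d) {s : Finset V} (hs : s ∈ K) (hsT : #s ∈ T) :
    ∃ x : RankSelected (truncatedRank K d) T, vertices x = s :=
  ⟨⟨⟨⟨s, Or.inr hs⟩, hT hsT⟩, hsT⟩, rfl⟩

theorem eq_of_card_vertices_eq {C : Set (RankSelected (truncatedRank K d) T)}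
    (hC : IsChain (· ≤ ·) C) {x y : RankSelected (truncatedRank K d) T} (hx : x ∈ C) (hy : y ∈ C)
    (h : #(vertices x) = #(vertices y)) : x = y := by
  apply vertices_injective
  rcases hC.total hx hy with hle | hle
  · exact eq_of_subset_of_card_le hle h.ge
  · exact (eq_of_subset_of_card_le hle h.le).symm

/-- A maximal chain of the rank-selected face poset of a pure complex meets every rank. -/
theorem exists_mem_flag (hdim : HasDim K d) (hp : IsPure K) (hT : T ⊆ Icc 1 d)
    (C : Flag (RankSelected (truncatedRank K d) T)) {k : ℕ} (hk : k ∈ T) :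
    ∃ x ∈ C, #(vertices x) = k := by
  classical
  by_contra! hno
  have hchain : IsChain (· ≤ ·) (C : Set (RankSelected (truncatedRank K d) T)) := C.chain_le
  have hk1 := mem_Icc.1 (hT hk)
  -- `a` is the largest chain member below rank `k`, or empty if there is none.
  obtain ⟨a, hak, haC, ha⟩ : ∃ a : Finset V, #a < k ∧ (∀ y ∈ C, k < #(vertices y) →
      a ⊆ vertices y) ∧ (a = ∅ ∨ a ∈ K) ∧ ∀ y ∈ C, #(vertices y) < k → vertices y ⊆ a := by
    by_cases hne : {j ∈ T | j < k ∧ ∃ x ∈ C, #(vertices x) = j}.Nonempty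
    · obtain ⟨j, hj, hmax⟩ := exists_max_image _ id hne
      obtain ⟨hjT, hjk, x, hxC, rfl⟩ := mem_filter.1 hj
      refine ⟨vertices x, hjk, fun y hy hyk => ?_, Or.inr (vertices_mem x), fun y hy hyk => ?_⟩
      · rcases hchain.total hxC hy with h | h
        · exact h
        · have := card_le_card (show vertices y ⊆ vertices x from h)
          omega
      · have hle : #(vertices y) ≤ #(vertices x) :=
          hmax _ (mem_filter.2 ⟨card_vertices_mem y, hyk, y, hy, rfl⟩)
        rcases hchain.total hxC hy with h | h
        · exact (eq_of_subset_of_card_le (show vertices x ⊆ vertices y from h) hle).ge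
        · exact h
    · refine ⟨∅, by simp; omega, by simp, Or.inl rfl, fun y hy hyk => ?_⟩
      exact absurd ⟨_, mem_filter.2 ⟨card_vertices_mem y, hyk, y, hy, rfl⟩⟩ hne
  -- `b` is the smallest chain member above rank `k`; failing that, a facet over `a`, whose size `d
  -- + 1` exceeds `k` by purity. A face of size `k` between `a` and `b` then extends the chain.
  obtain ⟨b, hbk, hbK, hab, hb⟩ : ∃ b : Finset V, k < #b ∧ b ∈ K ∧ a ⊆ b ∧
      ∀ y ∈ C, k < #(vertices y) → b ⊆ vertices y := by
    by_cases hne : {j ∈ T | k < j ∧ ∃ x ∈ C, #(vertices x) = j}.Nonempty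
    · obtain ⟨j, hj, hmin⟩ := exists_min_image _ id hne
      obtain ⟨hjT, hjk, x, hxC, rfl⟩ := mem_filter.1 hj
      refine ⟨vertices x, hjk, vertices_mem x, haC x hxC hjk, fun y hy hyk => ?_⟩
      have hle : #(vertices x) ≤ #(vertices y) :=
        hmin _ (mem_filter.2 ⟨card_vertices_mem y, hyk, y, hy, rfl⟩)
      rcases hchain.total hxC hy with h | h
      · exact h
      · exact (eq_of_subset_of_card_le (show vertices y ⊆ vertices x from h) hle).ge
    · obtain ⟨u, hu, hau⟩ : ∃ u, IsFacet K u ∧ a ⊆ u := by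
        rcases ha.1 with rfl | h
        · obtain ⟨s, hs, -⟩ := hdim.1
          obtain ⟨u, hu, -⟩ := hdim.exists_isFacet hs
          exact ⟨u, hu, empty_subset _⟩
        · exact hdim.exists_isFacet h
      refine ⟨u, by rw [hdim.card_facet hp hu]; omega, hu.1, hau, fun y hy hyk => ?_⟩
      exact absurd ⟨_, mem_filter.2 ⟨card_vertices_mem y, hyk, y, hy, rfl⟩⟩ hne
  obtain ⟨s, has, hsb, hsk⟩ := exists_subsuperset_card_eq hab hak.le hbk.le
  have hsK : s ∈ K := (K.isRelLowerSet_faces hbK).2 hsb (card_pos.1 (by omega))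
  obtain ⟨x, rfl⟩ := exists_vertices_eq hT hsK (hsk ▸ hk)
  have hins : IsChain (· ≤ ·) (insert x (C : Set (RankSelected (truncatedRank K d) T))) := by
    refine hchain.insert fun y hy _ => ?_
    rcases lt_or_gt_of_ne (hno y hy) with h | h
    · exact Or.inr ((ha.2 y hy h).trans has)
    · exact Or.inl (hsb.trans (hb y hy h))
  have hxC : x ∈ C := by
    have := C.max_chain' hins (Set.subset_insert _ _)
    change x ∈ C.carrier
    rw [this]
    exact Set.mem_insert _ _
  exact hno x hxC hsk

/-- A nested family of faces, one of each size in `T`, is a maximal chain. -/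
theorem exists_flag_of_nested (hT : T ⊆ Icc 1 d) {A : ℕ → Finset V}
    (hK : ∀ k ∈ T, A k ∈ K) (hcard : ∀ k ∈ T, #(A k) = k)
    (hmono : ∀ k ∈ T, ∀ l ∈ T, k ≤ l → A k ⊆ A l) :
    ∃ C : Flag (RankSelected (truncatedRank K d) T),
      ∀ x, x ∈ C ↔ vertices x = A #(vertices x) := by
  let C : Set (RankSelected (truncatedRank K d) T) := {x | vertices x = A #(vertices x)}
  have hchain : IsChain (· ≤ ·) C := by
    intro x hx y hy _
    have key : ∀ x ∈ C, ∀ y ∈ C, #(vertices x) ≤ #(vertices y) → vertices x ⊆ vertices y := by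
      intro x hx y hy h
      rw [show vertices x = A #(vertices x) from hx, show vertices y = A #(vertices y) from hy]
      exact hmono _ (card_vertices_mem x) _ (card_vertices_mem y) h
    exact (le_total #(vertices x) #(vertices y)).imp (key x hx y hy) (key y hy x hx)
  refine ⟨⟨C, hchain, fun D hD hCD => hCD.antisymm fun x hx => ?_⟩, fun x => Iff.rfl⟩
  -- `C` already has a member of each rank in `T`, and a chain has at most one per rank.
  have hxT := card_vertices_mem x
  obtain ⟨y, hy⟩ := exists_vertices_eq hT (hK _ hxT) ((hcard _ hxT).symm ▸ hxT)
  have hyx : #(vertices y) = #(vertices x) := by rw [hy, hcard _ hxT]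
  have hyC : y ∈ C := by
    change vertices y = A #(vertices y)
    rw [hyx, hy]
  rwa [eq_of_card_vertices_eq hD hx (hCD hyC) hyx.symm]

end Flags

/-! ### The flag vectors of a shellable complex -/

section Shellable

variable {V : Type*} {K : PreAbstractSimplicialComplex V} {d t : ℕ} {T : Finset ℕ}

/-- The prefix of length `k` of the word obtained by permuting the vertices `e` by `w`. -/
noncomputable def wordPrefix {n : ℕ} (e : Fin (n + 1) → V) (w : Equiv.Perm (Fin (n + 1)))
    (k : ℕ) : Finset V := by
  classical exact ({p : Fin (n + 1) | (p : ℕ) < k} : Finset _).image fun p => e (w p)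

section WordPrefix

variable {n : ℕ} {e : Fin (n + 1) → V} (w : Equiv.Perm (Fin (n + 1))) {k l : ℕ}

theorem mem_wordPrefix {v : V} : v ∈ wordPrefix e w k ↔ ∃ p : Fin (n + 1), (p : ℕ) < k ∧ e (w p) = v := by
  simp [wordPrefix]

theorem apply_mem_wordPrefix (he : Function.Injective e) {x : Fin (n + 1)} :
    e x ∈ wordPrefix e w k ↔ (w.symm x : ℕ) < k := by
  rw [mem_wordPrefix]
  constructor
  · rintro ⟨p, hp, h⟩
    rwa [← he h, w.symm_apply_apply]
  · exact fun h => ⟨_, h, by simp⟩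

theorem card_wordPrefix (he : Function.Injective e) (hk : k ≤ n + 1) :
    #(wordPrefix e w k) = k := by
  classical
  rw [wordPrefix, card_image_of_injective (f := fun p => e (w p)) _ (he.comp w.injective),
    Fin.card_filter_val_lt]
  exact min_eq_right hk

theorem wordPrefix_mono (h : k ≤ l) : wordPrefix e w k ⊆ wordPrefix e w l := by
  intro v hv
  rw [mem_wordPrefix] at hv ⊢
  exact hv.imp fun p hp => ⟨hp.1.trans_le h, hp.2⟩

end WordPrefix

/-- The rank-selected flag f-vector of a shellable complex counts pairs of a facet and a
permutation with descents in the rank set, whose last letter is outside the restriction of the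
facet. -/
theorem flagF_eq_card (hdim : HasDim K d) (hp : IsPure K) {F : Fin t → Finset V}
    (hF : IsShelling K F) {e : Fin t → Fin (d + 1) → V}
    (he : ∀ i, Function.Injective (e i)) (heF : ∀ i v, v ∈ F i ↔ ∃ p, e i p = v)
    (hup : ∀ i p q, p ≤ q → e i p ∈ restriction F i → e i q ∈ restriction F i)
    (hT : T ⊆ Icc 1 d) :
    flagF (truncatedRank K d) T =
      Nat.card {x : Fin t × Equiv.Perm (Fin (d + 1)) //
        e x.1 (x.2 (Fin.last d)) ∉ restriction F x.1 ∧ descentSet x.2 ⊆ T} := by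
  classical
  have hfacet : ∀ i, IsFacet K (F i) := fun i => by
    have : F i ∈ {s | IsFacet K s} := hF.2.1 ▸ Set.mem_range_self i
    exact this
  have hle : ∀ {k}, k ∈ T → k ≤ d := fun hk => (mem_Icc.1 (hT hk)).2
  have hsub : ∀ i (w : Equiv.Perm (Fin (d + 1))) k, wordPrefix (e i) w k ⊆ F i := by
    intro i w k v hv
    obtain ⟨p, -, rfl⟩ := (mem_wordPrefix w).1 hv
    exact (heF i _).2 ⟨_, rfl⟩
  have hprefixK : ∀ i (w : Equiv.Perm (Fin (d + 1))), ∀ k ∈ T, wordPrefix (e i) w k ∈ K := by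
    intro i w k hk
    refine (K.isRelLowerSet_faces (hfacet i).1).2 (hsub i w k) (card_pos.1 ?_)
    rw [card_wordPrefix w (he i) ((hle hk).trans (Nat.le_succ d))]
    exact (mem_Icc.1 (hT hk)).1
  have hprefixCard : ∀ i (w : Equiv.Perm (Fin (d + 1))), ∀ k ∈ T,
      #(wordPrefix (e i) w k) = k :=
    fun i w k hk => card_wordPrefix w (he i) ((hle hk).trans (Nat.le_succ d))
  choose Φ hΦ using fun x : Fin t × Equiv.Perm (Fin (d + 1)) =>
    exists_flag_of_nested hT (hprefixK x.1 x.2) (hprefixCard x.1 x.2)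
      fun k _ l _ h => wordPrefix_mono x.2 h
  -- A restriction vertex after the last cut would force the larger last letter into the upper set.
  -- For empty `T` the supremum is 0 and the prefix is empty.
  have hrestr : ∀ i (w : Equiv.Perm (Fin (d + 1))), descentSet w ⊆ T →
      e i (w (Fin.last d)) ∉ restriction F i →
        restriction F i ⊆ wordPrefix (e i) w (T.sup id) := by
    intro i w hw hl v hv
    obtain ⟨x, rfl⟩ := (heF i v).1 (mem_filter.1 hv).1
    rw [apply_mem_wordPrefix w (he i)]
    by_contra! hge
    refine hl (hup i x _ ?_ hv)
    rcases (Fin.le_last (w.symm x)).eq_or_lt with h | h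
    · rw [← h, w.apply_symm_apply]
    · have := lt_of_forall_notMem_descentSet h fun k hk hc =>
        (hc.1.trans_le (le_sup (f := id) (hw hk))).not_ge hge
      rw [w.apply_symm_apply] at this
      exact this.le
  have hprefix_eq : ∀ x y : Fin t × Equiv.Perm (Fin (d + 1)), Φ x = Φ y → ∀ k ∈ T,
      wordPrefix (e x.1) x.2 k = wordPrefix (e y.1) y.2 k := by
    intro x y hxy k hk
    obtain ⟨z, hz⟩ := exists_vertices_eq hT (hprefixK x.1 x.2 k hk)
      ((hprefixCard x.1 x.2 k hk).symm ▸ hk)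
    have hzk : #(vertices z) = k := by rw [hz, hprefixCard _ _ _ hk]
    have hzx : z ∈ Φ x := by rw [hΦ, hzk, hz]
    rw [hxy, hΦ, hzk, hz] at hzx
    exact hzx
  symm
  refine Nat.card_eq_of_bijective (fun x => Φ x.1) ⟨?_, ?_⟩
  · rintro ⟨⟨i, w⟩, hl, hw⟩ ⟨⟨i', w'⟩, hl', hw'⟩ h
    have heq := hprefix_eq _ _ h
    dsimp only at hl hw hl' hw' heq
    have hsup : wordPrefix (e i) w (T.sup id) = wordPrefix (e i') w' (T.sup id) := by
      rcases T.eq_empty_or_nonempty with rfl | hne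
      · simp [wordPrefix]
      · obtain ⟨k, hk, hks⟩ := exists_mem_eq_sup T hne id
        rw [hks]
        exact heq k hk
    -- Both facets contain the common top prefix and neither has an earlier facet containing it, so
    -- they coincide.
    have h1 := (hF.restriction_subset_iff (hsub i w _)).1 (hrestr i w hw hl)
    have h2 := (hF.restriction_subset_iff (hsub i' w' _)).1 (hrestr i' w' hw' hl')
    obtain rfl : i = i' := by
      rcases lt_trichotomy i i' with hlt | rfl | hlt
      · exact absurd (hsup ▸ hsub i w _) (h2 i hlt)
      · rfl
      · exact absurd (hsup ▸ hsub i' w' _) (h1 i' hlt)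
    obtain rfl : w = w' := eq_of_forall_lt_iff hw hw' fun k hk x => by
      rw [← apply_mem_wordPrefix w (he i), ← apply_mem_wordPrefix w' (he i), heq k hk]
    rfl
  · intro C
    have hchain : IsChain (· ≤ ·) (C : Set (RankSelected (truncatedRank K d) T)) := C.chain_le
    have hex : ∀ k, ∃ s : Finset V, k ∈ T → ∃ x ∈ C, vertices x = s ∧ #s = k := by
      intro k
      by_cases hk : k ∈ T
      · obtain ⟨x, hx, hxk⟩ := exists_mem_flag hdim hp hT C hk
        exact ⟨vertices x, fun _ => ⟨x, hx, rfl, hxk⟩⟩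
      · exact ⟨∅, fun h => absurd h hk⟩
    choose A hA using hex
    have hAmono : ∀ k ∈ T, ∀ l ∈ T, k ≤ l → A k ⊆ A l := by
      intro k hk l hl hkl
      obtain ⟨x, hx, hxA, hxk⟩ := hA k hk
      obtain ⟨y, hy, hyA, hyl⟩ := hA l hl
      rw [← hxA, ← hyA]
      rcases hchain.total hx hy with h | h
      · exact h
      · refine (eq_of_subset_of_card_le (show vertices y ⊆ vertices x from h) ?_).ge
        rw [hxA, hyA]
        omega
    obtain ⟨top, htop, htopF, htopA⟩ : ∃ top : Finset V, (∀ k ∈ T, A k ⊆ top) ∧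
        (∃ i, top ⊆ F i) ∧ (top = ∅ ∨ ∃ k ∈ T, top = A k) := by
      have hfac : ∀ u, IsFacet K u → ∃ i, F i = u := fun u hu => by
        have : u ∈ Set.range F := hF.2.1 ▸ hu
        exact this
      rcases T.eq_empty_or_nonempty with rfl | hne
      · obtain ⟨s, hs, -⟩ := hdim.1
        obtain ⟨u, hu, -⟩ := hdim.exists_isFacet hs
        obtain ⟨i, -⟩ := hfac u hu
        exact ⟨∅, by simp, ⟨i, empty_subset _⟩, Or.inl rfl⟩
      · obtain ⟨m, hm, hmax⟩ := exists_max_image T id hne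
        obtain ⟨x, -, hxA, -⟩ := hA m hm
        obtain ⟨u, hu, hxu⟩ := hdim.exists_isFacet (vertices_mem x)
        obtain ⟨i, rfl⟩ := hfac u hu
        exact ⟨A m, fun k hk => hAmono k hk m hm (hmax k hk), ⟨i, hxA ▸ hxu⟩,
          Or.inr ⟨m, hm, rfl⟩⟩
    -- Take the first facet containing the top face.
    obtain ⟨i, hi, hmin⟩ := exists_min_image {i | top ⊆ F i} id
      (htopF.imp fun i h => by simpa using h)
    replace hi : top ⊆ F i := by simpa using hi
    have hrtop : restriction F i ⊆ top := (hF.restriction_subset_iff hi).2 fun j hj hjt =>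
      (hmin j (by simpa using hjt)).not_gt hj
    obtain ⟨w, hw, hwA⟩ := exists_perm_of_nested (n := d) (T := T)
      (A := fun k => {x | e i x ∈ A k})
      (fun k hk => by
        obtain ⟨-, -, -, hcard⟩ := hA k hk
        rw [← card_image_of_injective _ (he i)]
        refine Eq.trans (congrArg card ?_) hcard
        ext v
        simp only [mem_image, mem_filter, mem_univ, true_and]
        constructor
        · rintro ⟨x, hx, rfl⟩
          exact hx
        · intro hv
          obtain ⟨x, rfl⟩ := (heF i v).1 (hi (htop k hk hv))
          exact ⟨x, hv, rfl⟩)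
      (fun k hk l hl hkl x hx => by
        simp only [mem_filter, mem_univ, true_and] at hx ⊢
        exact hAmono k hk l hl hkl hx)
    simp only [mem_filter, mem_univ, true_and] at hwA
    have hAprefix : ∀ k ∈ T, wordPrefix (e i) w k = A k := by
      intro k hk
      ext v
      rw [mem_wordPrefix]
      constructor
      · rintro ⟨p, hp, rfl⟩
        exact (hwA k hk p).2 hp
      · intro hv
        obtain ⟨x, rfl⟩ := (heF i v).1 (hi (htop k hk hv))
        refine ⟨w.symm x, (hwA k hk _).1 (by simpa using hv), by simp⟩
    refine ⟨⟨(i, w), fun hl => ?_, hw⟩, ?_⟩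
    · have := hrtop hl
      rcases htopA with rfl | ⟨k, hk, rfl⟩
      · exact absurd this (notMem_empty _)
      -- The last letter has position `d`, hence is outside every prefix of length `k ≤ d`.
      · have := (hwA k hk _).1 this
        exact absurd (hle hk) (not_le.2 this)
    -- By maximality of `Φ (i, w)`, one inclusion suffices.
    · refine SetLike.coe_injective (((Φ (i, w)).max_chain' hchain fun x hx => ?_))
      have hxT := card_vertices_mem x
      obtain ⟨y, hy, hyA, hyk⟩ := hA _ hxT
      have hxA : vertices x = A #(vertices x) := by
        rw [← hAprefix _ hxT]
        exact (hΦ (i, w) x).1 hx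
      have : x = y := vertices_injective (hxA.trans hyA.symm)
      exact this ▸ hy

open Classical in
/-- The flag h-vector of a shellable complex counts pairs of a facet and a permutation with
prescribed descent set, whose last letter is outside the restriction of the facet. -/
theorem flagHVec_eq_card (hdim : HasDim K d) (hp : IsPure K) {F : Fin t → Finset V}
    (hF : IsShelling K F) {e : Fin t → Fin (d + 1) → V}
    (he : ∀ i, Function.Injective (e i)) (heF : ∀ i v, v ∈ F i ↔ ∃ p, e i p = v)
    (hup : ∀ i p q, p ≤ q → e i p ∈ restriction F i → e i q ∈ restriction F i)
    (hT : T ⊆ Icc 1 d) :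
    flagHVec (truncatedRank K d) T =
      #{x ∈ {x : Fin t × Equiv.Perm (Fin (d + 1)) |
        e x.1 (x.2 (Fin.last d)) ∉ restriction F x.1} | descentSet x.2 = T} := by
  rw [← sum_powerset_neg_one_pow_mul_card _ (fun x : Fin t × Equiv.Perm (Fin (d + 1)) => descentSet x.2),
    flagHVec]
  refine sum_congr rfl fun R hR => ?_
  rw [flagF_eq_card hdim hp hF he heF hup ((mem_powerset.1 hR).trans hT),
    Nat.card_eq_fintype_card, Fintype.card_subtype, filter_filter]

end Shellable

end FlagH

/-! ### Dominance and the flag h-vector -/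

theorem mainTheorem7 {V : Type*} (K : PreAbstractSimplicialComplex V) (d : ℕ)
    (hdim : FlagH.HasDim K d) (hK : FlagH.IsShellable K)
    (S T : Finset ℕ) (hS : S ⊆ Finset.Icc 1 d) (hT : T ⊆ Finset.Icc 1 d)
    (hST : FlagH.Dominates d S T) :
    FlagH.flagHVec (FlagH.truncatedRank K d) T ≤ FlagH.flagHVec (FlagH.truncatedRank K d) S := by
  classical
  obtain ⟨hp, t, F, hF⟩ := hK
  have hcard : ∀ i, (F i).card = d + 1 := fun i =>
    hdim.card_facet hp (show F i ∈ {s | FlagH.IsFacet K s} from hF.2.1 ▸ Set.mem_range_self i)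
  choose e he heF hup using fun i => FlagH.exists_labelling (F i) (FlagH.restriction F i) (hcard i)
  rw [FlagH.flagHVec_eq_card hdim hp hF he heF hup hT,
    FlagH.flagHVec_eq_card hdim hp hF he heF hup hS, Nat.cast_le]
  obtain ⟨φ, hφ, hle⟩ := hST
  refine Finset.card_le_card_of_injOn
    -- The facet is kept and `φ` acts on the permutation; the `else` value is never used on the
    -- source set.
    (fun x => if h : FlagH.descentSet x.2 = T then (x.1, (φ ⟨x.2, h⟩).1) else x) ?_ ?_
  · intro x hx
    simp only [Finset.coe_filter, Finset.mem_filter, Finset.mem_univ, true_and,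
      Set.mem_ofPred_eq] at hx ⊢
    rw [dif_pos hx.2]
    exact ⟨fun h => hx.1 (hup _ _ _ (hle ⟨x.2, hx.2⟩).last_le h), (φ ⟨x.2, hx.2⟩).2⟩
  · rintro ⟨i, w⟩ hx ⟨i', w'⟩ hx' h
    simp only [Finset.coe_filter, Finset.mem_filter, Finset.mem_univ, true_and,
      Set.mem_ofPred_eq] at hx hx'
    simp only [dif_pos hx.2, dif_pos hx'.2, Prod.mk.injEq] at h
    have := hφ (Subtype.ext h.2)
    simp only [Subtype.mk.injEq] at this
    rw [h.1, this]
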